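/- Let $0<a_1<a_2$, $c_1>c_2>0$ and $T\in(0,\infty)$. For $N\in\mathbb N$ let $B_1,\dots,B_N$ be mutually independent standard Brownian motions on some probability space, and put $$\psi_T(N)=\mathbb P\Big(\sup_{t\in[0,T]}\Big(\sum_{k=1}^N B_k(t)-c_1Nt\Big)>a_1N,\ \sup_{t\in[0,T]}\Big(\sum_{k=1}^N B_k(t)-c_2Nt\Big)>a_2N\Big).$$ Let $t^*=\frac{a_2-a_1}{c_1-c_2}$ be the point where the lines $a_1+c_1t$ and $a_2+c_2t$ intersect, and let $t_2=\frac{a_2}{c_2}$. Suppose that $t^*\ge T$. Then, as $N\to\infty$, where $f(N)\sim g(N)$ means $f(N)/g(N)\to1$: (i) if $t_2>T$, then $$\psi_T(N)\sim\frac1{\sqrt{2\pi}}\left(\frac{\sqrt T}{a_2+c_2T}+\frac{\sqrt T}{a_2-c_2T}\right)\frac1{\sqrt N}\,e^{-\frac{(a_2+c_2T)^2}{2T}N};$$ (ii) if $t_2=T$, then $\psi_T(N)\sim\frac12e^{-2a_2c_2N}$; (iii) if $t_2<T$, then $\psi_T(N)\sim e^{-2a_2c_2N}$. -/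

import Mathlib

open MeasureTheory ProbabilityTheory Filter Asymptotics
open scoped NNReal

namespace ManySource

/-- The supremum over `t ∈ [0, T]` of `∑ k, B k t - c N t`, where `N` is the number of sources,
along the path `ω`. It is taken in the extended reals, so that it is the true supremum for
every `ω`, also where the path happens to be unbounded. -/
noncomputable def supremum {Ω : Type*} {N : ℕ} (B : Fin N → ℝ≥0 → Ω → ℝ) (c : ℝ) (T : ℝ≥0)
    (ω : Ω) : EReal :=
  ⨆ t : Set.Icc (0 : ℝ≥0) T, (((∑ k, B k t ω) - c * N * ((t : ℝ≥0) : ℝ) : ℝ) : EReal)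

/-- The joint exceedance probability: the probability that
`sup_{t ∈ [0,T]} (∑ k, B k t - c₁ N t) > a₁ N` and
`sup_{t ∈ [0,T]} (∑ k, B k t - c₂ N t) > a₂ N`. -/
noncomputable def psi {Ω : Type*} [MeasurableSpace Ω] (P : Measure Ω) {N : ℕ}
    (B : Fin N → ℝ≥0 → Ω → ℝ) (a₁ a₂ c₁ c₂ : ℝ) (T : ℝ≥0) : ℝ :=
  P.real {ω | supremum B c₁ T ω > ((a₁ * N : ℝ) : EReal) ∧
    supremum B c₂ T ω > ((a₂ * N : ℝ) : EReal)}

/-- `N` mutually independent standard Brownian motions (as random paths) under `P`. -/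
structure IsIndepBrownian {Ω : Type*} [MeasurableSpace Ω] (P : Measure Ω) {N : ℕ}
    (B : Fin N → ℝ≥0 → Ω → ℝ) : Prop where
  brownian : ∀ k, IsBrownianReal (B k) P
  indep : iIndepFun (fun k ω t => B k t ω) P

/-- The time `t*` at which the lines `a₁ + c₁ t` and `a₂ + c₂ t` meet. -/
noncomputable def tStar (a₁ a₂ c₁ c₂ : ℝ) : ℝ := (a₂ - a₁) / (c₁ - c₂)

/-- The time `a / c`, at which the variance `t ↦ N t / (a + c t) ^ 2` of
`∑ k, B k t / (a + c t)` is maximal over `t ≥ 0`. -/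
noncomputable def critTime (a c : ℝ) : ℝ := a / c

end ManySource

/-! Since `T ≤ t*`, the second line lies above the first on `[0, T]`, so the joint event is the
passage of the second line alone. Scaling the sum by `1/√N` gives one Brownian motion `W`, and
`psi_eq` follows from the exact passage law `measure_exists_drift_gt`.

That law replaces the reflection principle by a weight. Put `X t = W t - c t` and `h x = (1 + exp
(2cx)) 1_{x > 0}`. Exponential tilting and Gaussian symmetry give `E h(X s) = 1` for `s > 0`, so, by
independence of increments, if `σ < T` is the first grid time above `a`, then `P(σ = t_k) = E[h(X T
- X t_k); σ = t_k]`. As `h` is monotone and `X σ` is close to `a` on fine grids, the passage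
probability is `E h(X T - a)`, a sum of two Gaussian tails.

With `u, v = (a₂ ± c₂T)/√T`, the identity `u²/2 = 2a₂c₂ + v²/2` compares the two tails: for `v > 0`
they have the same order and Mills' ratio gives both constants; for `v ≤ 0` the second dominates,
its tail factor being `1/2` at `v = 0` and tending to `1` for `v < 0`. -/

namespace ManySource

/-! ### The reflection weight and its mean -/

open Set
open scoped ENNReal Topology

/-- The function `x ↦ (1 + exp (2 c x)) 1_{x > 0}`, whose expectation at a Brownian motion with
drift `-c` started from `0` is `1` at every positive time. -/
noncomputable def reflWeight (c x : ℝ) : ℝ≥0∞ :=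
  (Ioi 0).indicator (fun x => 1 + ENNReal.ofReal (Real.exp (2 * c * x))) x

lemma measurable_reflWeight (c : ℝ) : Measurable (reflWeight c) := by
  unfold reflWeight
  exact Measurable.indicator (by fun_prop) measurableSet_Ioi

lemma monotone_reflWeight {c : ℝ} (hc : 0 ≤ c) : Monotone (reflWeight c) := by
  intro x y hxy
  unfold reflWeight
  by_cases hx : x ∈ Ioi (0 : ℝ)
  · have hy : y ∈ Ioi (0 : ℝ) := lt_of_lt_of_le hx hxy
    rw [indicator_of_mem hx, indicator_of_mem hy]
    gcongr
  · simp [indicator_of_notMem hx]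

/-- The weight jumps at `0` but vanishes there, so it is left-continuous; hence the approach from
below. -/
lemma tendsto_reflWeight_sub (c x : ℝ) {d : ℕ → ℝ} (hd : Tendsto d atTop (𝓝 0))
    (hd0 : ∀ n, 0 ≤ d n) : Tendsto (fun n => reflWeight c (x - d n)) atTop (𝓝 (reflWeight c x)) := by
  have hlim : Tendsto (fun n => x - d n) atTop (𝓝 x) := by simpa using tendsto_const_nhds.sub hd
  rcases le_or_gt x 0 with hx | hx
  · have h : ∀ y ≤ x, reflWeight c y = 0 := fun y hy =>
      indicator_of_notMem (by simpa using hy.trans hx) _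
    rw [h x le_rfl]
    simp_rw [fun n => h (x - d n) (by linarith [hd0 n])]
    exact tendsto_const_nhds
  · have hev : ∀ᶠ n in atTop, x - d n ∈ Ioi (0 : ℝ) := hlim.eventually (lt_mem_nhds hx)
    have hcont : Continuous fun y : ℝ => 1 + ENNReal.ofReal (Real.exp (2 * c * y)) :=
      continuous_const.add (ENNReal.continuous_ofReal.comp (by fun_prop))
    have := (hcont.tendsto x).comp hlim
    unfold reflWeight
    rw [indicator_of_mem (show x ∈ Ioi (0 : ℝ) from hx)]
    refine this.congr' ?_
    filter_upwards [hev] with n hn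
    rw [indicator_of_mem hn, Function.comp_apply]

/-- Exponential tilting of a Gaussian measure with drift `-c` turns its drift into `c`. -/
lemma setLIntegral_exp_gaussianReal (c : ℝ) {s : ℝ≥0} (hs : s ≠ 0) {A : Set ℝ}
    (hA : MeasurableSet A) :
    ∫⁻ x in A, ENNReal.ofReal (Real.exp (2 * c * x)) ∂gaussianReal (-(c * s)) s =
      gaussianReal (c * s) s A := by
  rw [gaussianReal_of_var_ne_zero _ hs, gaussianReal_apply _ hs,
    setLIntegral_withDensity_eq_setLIntegral_mul _ (measurable_gaussianPDF _ _) (by fun_prop) hA]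
  refine lintegral_congr fun x => ?_
  simp only [Pi.mul_apply, gaussianPDF, gaussianPDFReal]
  rw [← ENNReal.ofReal_mul (by positivity), mul_assoc, ← Real.exp_add]
  congr 4
  have : (s : ℝ) ≠ 0 := by exact_mod_cast hs
  field_simp
  ring

lemma lintegral_reflWeight (a c : ℝ) {s : ℝ≥0} (hs : s ≠ 0) :
    ∫⁻ x, reflWeight c (x - a) ∂gaussianReal (-(c * s)) s =
      gaussianReal (-(c * s)) s (Ioi a) +
        ENNReal.ofReal (Real.exp (-(2 * c * a))) * gaussianReal (c * s) s (Ioi a) := by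
  have h : ∀ x, reflWeight c (x - a) = (Ioi a).indicator (fun x => 1 +
      ENNReal.ofReal (Real.exp (-(2 * c * a))) * ENNReal.ofReal (Real.exp (2 * c * x))) x := by
    intro x
    unfold reflWeight
    by_cases hx : a < x
    · rw [indicator_of_mem (by simpa using hx), indicator_of_mem (by simpa using hx),
        ← ENNReal.ofReal_mul (by positivity), ← Real.exp_add]
      congr 3
      ring
    · rw [indicator_of_notMem (by simpa using hx), indicator_of_notMem (by simpa using hx)]
  simp_rw [h]
  rw [lintegral_indicator measurableSet_Ioi, lintegral_add_left measurable_const,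
    lintegral_const_mul _ (by fun_prop), setLIntegral_exp_gaussianReal c hs measurableSet_Ioi]
  simp

/-- Tilting turns the exponential term into the mass of `Ioi 0` under the opposite drift, which by
symmetry is the mass of `Iio 0` under the original one. -/
lemma lintegral_reflWeight_zero (c : ℝ) {s : ℝ≥0} (hs : s ≠ 0) :
    ∫⁻ x, reflWeight c x ∂gaussianReal (-(c * s)) s = 1 := by
  have h := lintegral_reflWeight 0 c hs
  simp only [sub_zero, mul_zero, neg_zero, Real.exp_zero, ENNReal.ofReal_one, one_mul] at h
  rw [h, ← gaussianReal_map_neg, Measure.map_apply measurable_neg measurableSet_Ioi]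
  have h1 : (fun x : ℝ => -x) ⁻¹' Ioi 0 = Iio 0 := by ext; simp
  have := nullSingletonClass_gaussianReal (μ := c * s) hs
  have h2 : (Ioi (0 : ℝ)) = (Iic 0)ᶜ := by ext; simp
  rw [h1, measure_congr Iio_ae_eq_Iic, h2]
  exact prob_add_prob_compl measurableSet_Iic

variable {Ω : Type*} [MeasurableSpace Ω] {P : Measure Ω} {W : ℝ≥0 → Ω → ℝ}

lemma hasLaw_drift (hW : IsPreBrownianReal W P) (c : ℝ) (t : ℝ≥0) :
    HasLaw (fun ω => W t ω - c * t) (gaussianReal (-(c * t)) t) P := by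
  simpa using gaussianReal_sub_const (hW.hasLaw_eval t) (c * t)

lemma lintegral_reflWeight_drift (hW : IsPreBrownianReal W P) (a c : ℝ) (t : ℝ≥0) :
    ∫⁻ ω, reflWeight c (W t ω - c * t - a) ∂P =
      ∫⁻ x, reflWeight c (x - a) ∂gaussianReal (-(c * t)) t :=
  (hasLaw_drift hW c t).lintegral_comp
    ((measurable_reflWeight c).comp (measurable_id.sub_const a)).aemeasurable

/-- The weight of a future increment is independent of the past and has mean one. -/
lemma setLIntegral_reflWeight_increment (hW : IsPreBrownianReal W P) (c : ℝ) {t T : ℝ≥0}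
    (ht : t < T) {ι : Type*} [Countable ι] (τ : ι → Set.Iic t) {D : Set (ι → ℝ)}
    (hD : MeasurableSet D) :
    ∫⁻ ω in {ω | (fun i => W (τ i) ω) ∈ D},
      reflWeight c ((W T ω - c * T) - (W t ω - c * t)) ∂P = P {ω | (fun i => W (τ i) ω) ∈ D} := by
  obtain ⟨s, rfl⟩ := exists_add_of_le ht.le
  have hs : s ≠ 0 := by rintro rfl; simp at ht
  have hpast : AEMeasurable (fun ω i => W (τ i) ω) P :=
    aemeasurable_pi_lambda _ fun i => hW.aemeasurable _
  have hnull : NullMeasurableSet {ω | (fun i => W (τ i) ω) ∈ D} P :=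
    hpast.nullMeasurableSet_preimage hD
  have hind : IndepFun (fun ω => reflWeight c (W (t + s) ω - W t ω - c * s))
      (fun ω => D.indicator (1 : (ι → ℝ) → ℝ≥0∞) (fun i => W (τ i) ω)) P :=
    IndepFun.comp (φ := fun x : ℝ≥0 → ℝ => reflWeight c (x s - c * s))
      (ψ := fun x : Set.Iic t → ℝ => D.indicator (1 : (ι → ℝ) → ℝ≥0∞) (fun i => x (τ i)))
      (hW.indepFun_shift t)
      ((measurable_reflWeight c).comp ((measurable_pi_apply s).sub_const _))
      ((measurable_one.indicator hD).comp
        (measurable_pi_lambda _ fun i => measurable_pi_apply (τ i)))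
  have hshift := hW.shift t
  have hf : AEMeasurable (fun ω => reflWeight c (W (t + s) ω - W t ω - c * s)) P :=
    (measurable_reflWeight c).comp_aemeasurable ((hshift.aemeasurable s).sub_const _)
  have hg : AEMeasurable (fun ω => D.indicator (1 : (ι → ℝ) → ℝ≥0∞) (fun i => W (τ i) ω)) P :=
    (measurable_one.indicator hD).comp_aemeasurable hpast
  have h1 : ∫⁻ ω, reflWeight c (W (t + s) ω - W t ω - c * s) ∂P = 1 := by
    have := lintegral_reflWeight_drift hshift 0 c s
    simp only [sub_zero] at this
    rw [this, lintegral_reflWeight_zero c hs]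
  have h2 := lintegral_mul_eq_lintegral_mul_lintegral_of_indepFun'' hf hg hind
  rw [h1, one_mul] at h2
  rw [← lintegral_indicator₀ hnull, ← lintegral_indicator_one₀ hnull]
  refine Eq.trans (lintegral_congr fun ω => ?_) (h2.trans (lintegral_congr fun ω => ?_))
  · have : (W (t + s) ω - c * ((t + s : ℝ≥0) : ℝ)) - (W t ω - c * t) =
        W (t + s) ω - W t ω - c * s := by push_cast; ring
    rw [← this]
    by_cases h : (fun i => W (τ i) ω) ∈ D <;> simp [h, indicator]
  · simp [indicator]

end ManySource

namespace ManySource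

/-! ### First passage along a grid -/

open Set
open scoped ENNReal Topology

/-- The `k`-th point `k T / n` of the uniform grid of `[0, T]` with `n` steps. -/
noncomputable def gridPoint (T : ℝ≥0) (n k : ℕ) : ℝ≥0 := Real.toNNReal ((k : ℝ) / n * T)

lemma coe_gridPoint (T : ℝ≥0) (n k : ℕ) : (gridPoint T n k : ℝ) = (k : ℝ) / n * T :=
  Real.coe_toNNReal _ (by positivity)

lemma gridPoint_mono (T : ℝ≥0) (n : ℕ) : Monotone (gridPoint T n) := by
  intro j k hjk
  unfold gridPoint
  gcongr

lemma gridPoint_lt {T : ℝ≥0} (hT : 0 < T) {n k : ℕ} (hk : k < n) : gridPoint T n k < T := by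
  rw [← NNReal.coe_lt_coe, coe_gridPoint]
  have hT' : (0 : ℝ) < T := hT
  have h : (k : ℝ) / n < 1 := by
    rw [div_lt_one (by exact_mod_cast (Nat.zero_le k).trans_lt hk)]
    exact_mod_cast hk
  nlinarith

lemma eventually_exists_gridPoint {x : ℝ≥0 → ℝ} (hx : Continuous x) {a : ℝ} {t T : ℝ≥0}
    (hT : 0 < T) (htT : t ≤ T) (ht : a < x t) :
    ∀ᶠ n : ℕ in atTop, ∃ k < n, a < x (gridPoint T n k) := by
  obtain ⟨u, huT, hu⟩ : ∃ u < T, a < x u := by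
    rcases htT.lt_or_eq with h | rfl
    · exact ⟨t, h, ht⟩
    -- Only grid points with `k < n` count, so a passage at `T` itself is moved to an earlier time
    -- by continuity.
    · have hmem : t ∈ closure (Iio t) := by
        rw [closure_Iio' (a := t) ⟨0, hT⟩]; exact self_mem_Iic
      obtain ⟨u, hu, huT⟩ := mem_closure_iff.1 hmem _ (isOpen_lt continuous_const hx) ht
      exact ⟨u, huT, hu⟩
  have hT' : (0 : ℝ) < T := hT
  have hr : (0 : ℝ) ≤ u / T := by positivity
  have hr1 : (u : ℝ) / T < 1 := by rw [div_lt_one hT']; exact huT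
  have hlim : Tendsto (fun n : ℕ => gridPoint T n ⌊(u / T : ℝ) * n⌋₊) atTop (𝓝 u) := by
    have h1 := ((tendsto_nat_floor_mul_div_atTop hr).comp
      (tendsto_natCast_atTop_atTop (R := ℝ))).mul_const (T : ℝ)
    rw [div_mul_cancel₀ _ hT'.ne'] at h1
    have h2 := (continuous_real_toNNReal.tendsto _).comp h1
    rw [Real.toNNReal_coe] at h2
    exact h2
  have hev := ((hx.tendsto u).comp hlim).eventually (lt_mem_nhds hu)
  filter_upwards [hev, eventually_gt_atTop 0] with n hn hn0
  refine ⟨_, ?_, hn⟩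
  have hn0' : (0 : ℝ) < n := by exact_mod_cast hn0
  rw [Nat.floor_lt (by positivity)]
  nlinarith

/-- Uniform continuity bounds the change over one mesh step by `d`; the point before the first
passage is still at most `a`, so the overshoot is at most `d`. -/
lemma eventually_exists_first_gridPoint {x : ℝ≥0 → ℝ} (hx : Continuous x) {a d : ℝ} {T : ℝ≥0}
    (hT : 0 < T) (h0 : x 0 ≤ a) (hd : 0 < d) (h : a < x T) :
    ∀ᶠ n : ℕ in atTop, ∃ k < n, x (gridPoint T n k) ∈ Ioc a (a + d) ∧
      ∀ j < k, x (gridPoint T n j) ≤ a := by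
  have huc := isCompact_Icc.uniformContinuousOn_of_continuous (s := Icc 0 T) hx.continuousOn
  obtain ⟨η, hη, hunif⟩ := Metric.uniformContinuousOn_iff.1 huc d hd
  have hmesh : ∀ᶠ n : ℕ in atTop, (T : ℝ) / n < η :=
    (tendsto_const_div_atTop_nhds_zero_nat (T : ℝ)).eventually (gt_mem_nhds hη)
  filter_upwards [eventually_exists_gridPoint hx hT le_rfl h, hmesh] with n hn hmesh
  classical
  have hex : ∃ k, a < x (gridPoint T n k) := hn.imp fun _ h => h.2
  obtain ⟨k₀, hk₀, hk₀'⟩ := hn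
  have hfind : Nat.find hex < n := (Nat.find_min' hex hk₀').trans_lt hk₀
  have hmin : ∀ j < Nat.find hex, x (gridPoint T n j) ≤ a :=
    fun j hj => not_lt.1 (Nat.find_min hex hj)
  have hspec := Nat.find_spec hex
  refine ⟨_, hfind, ⟨hspec, ?_⟩, hmin⟩
  obtain ⟨m, hm⟩ : ∃ m, Nat.find hex = m + 1 := by
    refine Nat.exists_eq_succ_of_ne_zero fun h0' => ?_
    rw [h0'] at hspec
    have : gridPoint T n 0 = 0 := by simp [gridPoint]
    rw [this] at hspec
    linarith
  rw [hm] at hfind hmin ⊢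
  have hdist : dist (gridPoint T n (m + 1)) (gridPoint T n m) < η := by
    rw [NNReal.dist_eq, coe_gridPoint, coe_gridPoint]
    have : ((m + 1 : ℕ) : ℝ) / n * T - (m : ℝ) / n * T = T / n := by push_cast; ring
    rw [this, abs_of_nonneg (by positivity)]
    exact hmesh
  have hlast := hunif _ ⟨zero_le, (gridPoint_lt hT hfind).le⟩ _
    ⟨zero_le, (gridPoint_lt hT (m.lt_succ_self.trans hfind)).le⟩ hdist
  rw [Real.dist_eq] at hlast
  linarith [le_abs_self (x (gridPoint T n (m + 1)) - x (gridPoint T n m)), hmin m m.lt_succ_self]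

variable {Ω : Type*} {W : ℝ≥0 → Ω → ℝ}

/-- The event that `t ↦ W t - c t` first exceeds `a` along the grid of mesh `T / n` at the `k`-th
grid point, with a value in `S` there. -/
def gridPassage (W : ℝ≥0 → Ω → ℝ) (c a : ℝ) (T : ℝ≥0) (n : ℕ) (S : Set ℝ) (k : ℕ) : Set Ω :=
  {ω | W (gridPoint T n k) ω - c * gridPoint T n k ∈ S ∧
    ∀ j < k, W (gridPoint T n j) ω - c * gridPoint T n j ≤ a}

/-- The past up to the `k`-th grid point in which `gridPassage` holds. -/
def gridPassagePast (c a : ℝ) (T : ℝ≥0) (n : ℕ) (S : Set ℝ) (k : ℕ) : Set (Set.Iic k → ℝ) :=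
  {x | x ⟨k, self_mem_Iic⟩ - c * gridPoint T n k ∈ S ∧
    ∀ j : Set.Iio k, x ⟨j, le_of_lt (mem_Iio.1 j.2)⟩ - c * gridPoint T n j ≤ a}

lemma measurableSet_gridPassagePast (c a : ℝ) (T : ℝ≥0) (n : ℕ) {S : Set ℝ}
    (hS : MeasurableSet S) (k : ℕ) : MeasurableSet (gridPassagePast c a T n S k) := by
  unfold gridPassagePast
  rw [ofPred_and]
  refine MeasurableSet.inter ?_ ?_
  · exact measurableSet_preimage ((measurable_pi_apply _).sub_const _) hS
  · rw [ofPred_forall]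
    exact MeasurableSet.iInter fun j =>
      measurableSet_le ((measurable_pi_apply _).sub_const _) measurable_const

lemma gridPassage_eq (c a : ℝ) (T : ℝ≥0) (n : ℕ) (S : Set ℝ) (k : ℕ) :
    gridPassage W c a T n S k =
      {ω | (fun j : Set.Iic k => W (gridPoint T n j) ω) ∈ gridPassagePast c a T n S k} := by
  ext ω
  simp [gridPassage, gridPassagePast]

lemma pairwise_disjoint_gridPassage (c a : ℝ) (T : ℝ≥0) (n : ℕ) {S : Set ℝ} (hS : S ⊆ Ioi a) :
    Pairwise (Function.onFun Disjoint (gridPassage W c a T n S)) := by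
  have key : ∀ j k, j < k → Disjoint (gridPassage W c a T n S j) (gridPassage W c a T n S k) :=
    fun j k hjk => disjoint_left.2 fun ω hj hk => (not_le.2 (hS hj.1)) (hk.2 j hjk)
  intro j k hjk
  rcases hjk.lt_or_gt with h | h
  · exact key j k h
  · exact (key k j h).symm

variable [MeasurableSpace Ω] {P : Measure Ω}

lemma nullMeasurableSet_gridPassage (hW : IsPreBrownianReal W P) (c a : ℝ) (T : ℝ≥0) (n : ℕ)
    {S : Set ℝ} (hS : MeasurableSet S) (k : ℕ) :
    NullMeasurableSet (gridPassage W c a T n S k) P := by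
  rw [gridPassage_eq]
  exact (aemeasurable_pi_lambda _ fun j => hW.aemeasurable _).nullMeasurableSet_preimage
    (measurableSet_gridPassagePast c a T n hS k)

lemma setLIntegral_gridPassage (hW : IsPreBrownianReal W P) (c a : ℝ) {T : ℝ≥0} (hT : 0 < T)
    {n k : ℕ} (hk : k < n) {S : Set ℝ} (hS : MeasurableSet S) :
    ∫⁻ ω in gridPassage W c a T n S k, reflWeight c ((W T ω - c * T) -
      (W (gridPoint T n k) ω - c * gridPoint T n k)) ∂P = P (gridPassage W c a T n S k) := by
  rw [gridPassage_eq]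
  exact setLIntegral_reflWeight_increment hW c (gridPoint_lt hT hk)
    (fun j : Set.Iic k => ⟨gridPoint T n j, gridPoint_mono T n j.2⟩)
    (measurableSet_gridPassagePast c a T n hS k)

/-- At the passage point the path is above `a`, so replacing its value by `a` only increases the
weight of the remaining increment. -/
lemma measure_gridPassage_le (hW : IsPreBrownianReal W P) (a : ℝ) {c : ℝ} (hc : 0 ≤ c) {T : ℝ≥0}
    (hT : 0 < T) (n : ℕ) :
    P (⋃ k ∈ Finset.range n, gridPassage W c a T n (Ioi a) k) ≤
      ∫⁻ ω, reflWeight c (W T ω - c * T - a) ∂P := by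
  have hnull : ∀ k, NullMeasurableSet (gridPassage W c a T n (Ioi a) k) P :=
    nullMeasurableSet_gridPassage hW c a T n measurableSet_Ioi
  have hdisj : Set.Pairwise (Finset.range n : Set ℕ)
      (Function.onFun (AEDisjoint P) (gridPassage W c a T n (Ioi a))) :=
    fun j _ k _ hjk => (pairwise_disjoint_gridPassage c a T n subset_rfl hjk).aedisjoint
  calc _ ≤ ∑ k ∈ Finset.range n, P (gridPassage W c a T n (Ioi a) k) :=
        measure_biUnion_finset_le _ _
    _ ≤ ∑ k ∈ Finset.range n, ∫⁻ ω in gridPassage W c a T n (Ioi a) k,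
          reflWeight c (W T ω - c * T - a) ∂P := by
        refine Finset.sum_le_sum fun k hk => ?_
        rw [← setLIntegral_gridPassage hW c a hT (Finset.mem_range.1 hk) measurableSet_Ioi]
        rw [← lintegral_indicator₀ (hnull k), ← lintegral_indicator₀ (hnull k)]
        refine lintegral_mono fun ω => indicator_le_indicator' fun h => ?_
        exact monotone_reflWeight hc (by linarith [mem_Ioi.1 h.1])
    _ = ∫⁻ ω in ⋃ k ∈ Finset.range n, gridPassage W c a T n (Ioi a) k,
          reflWeight c (W T ω - c * T - a) ∂P :=
        (lintegral_biUnion_finset₀ hdisj (fun k _ => hnull k) _).symm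
    _ ≤ _ := setLIntegral_le_lintegral _ _

/-- Bounding the overshoot by `d` reverses the comparison: replacing the passage value by `a + d`
decreases the weight. -/
lemma le_measure_gridPassage (hW : IsPreBrownianReal W P) (a d : ℝ) {c : ℝ} (hc : 0 ≤ c)
    {T : ℝ≥0} (hT : 0 < T) (n : ℕ) :
    ∫⁻ ω in ⋃ k ∈ Finset.range n, gridPassage W c a T n (Ioc a (a + d)) k,
      reflWeight c (W T ω - c * T - a - d) ∂P ≤
      P (⋃ k ∈ Finset.range n, gridPassage W c a T n (Ioc a (a + d)) k) := by
  have hnull : ∀ k, NullMeasurableSet (gridPassage W c a T n (Ioc a (a + d)) k) P :=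
    nullMeasurableSet_gridPassage hW c a T n measurableSet_Ioc
  have hdisj : Set.Pairwise (Finset.range n : Set ℕ)
      (Function.onFun (AEDisjoint P) (gridPassage W c a T n (Ioc a (a + d)))) :=
    fun j _ k _ hjk => (pairwise_disjoint_gridPassage c a T n Ioc_subset_Ioi_self hjk).aedisjoint
  rw [lintegral_biUnion_finset₀ hdisj (fun k _ => hnull k),
    measure_biUnion_finset₀ hdisj (fun k _ => hnull k)]
  refine Finset.sum_le_sum fun k hk => ?_
  rw [← setLIntegral_gridPassage hW c a hT (Finset.mem_range.1 hk) measurableSet_Ioc]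
  rw [← lintegral_indicator₀ (hnull k), ← lintegral_indicator₀ (hnull k)]
  refine lintegral_mono fun ω => indicator_le_indicator' fun h => ?_
  exact monotone_reflWeight hc (by linarith [h.1.2])

/-! ### Passage law in continuous time -/

lemma measure_exists_drift_gt_le (hW : IsBrownianReal W P) (a : ℝ) {c : ℝ} (hc : 0 ≤ c) {T : ℝ≥0}
    (hT : 0 < T) :
    P {ω | ∃ t ≤ T, a < W t ω - c * t} ≤ ∫⁻ ω, reflWeight c (W T ω - c * T - a) ∂P := by
  set U : ℕ → Set Ω := fun n => ⋃ k ∈ Finset.range n, gridPassage W c a T n (Ioi a) k with hU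
  -- The grids are not nested, so the sets `U n` need not increase; their tail intersections do.
  have hsub : ∀ᵐ ω ∂P, ω ∈ {ω | ∃ t ≤ T, a < W t ω - c * t} → ω ∈ ⋃ m, ⋂ n ≥ m, U n := by
    filter_upwards [hW.cont] with ω hω ⟨t, htT, ht⟩
    have hx : Continuous fun t : ℝ≥0 => W t ω - c * t := by fun_prop
    obtain ⟨m, hm⟩ := eventually_atTop.1 (eventually_exists_gridPoint hx hT htT ht)
    refine mem_iUnion.2 ⟨m, mem_iInter₂.2 fun n hn => ?_⟩
    classical
    obtain ⟨k₀, hk₀, hk₀'⟩ := hm n hn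
    have hex : ∃ k, a < W (gridPoint T n k) ω - c * gridPoint T n k := ⟨k₀, hk₀'⟩
    refine mem_iUnion₂.2 ⟨Nat.find hex,
      Finset.mem_range.2 ((Nat.find_min' hex hk₀').trans_lt hk₀), Nat.find_spec hex, ?_⟩
    exact fun j hj => not_lt.1 (Nat.find_min hex hj)
  have hmono : Monotone fun m => ⋂ n ≥ m, U n := fun m m' h =>
    biInter_mono (fun n hn => h.trans hn) fun _ _ => subset_rfl
  refine (measure_mono_ae (t := ⋃ m, ⋂ n ≥ m, U n) hsub).trans ?_
  rw [hmono.measure_iUnion]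
  exact iSup_le fun m => (measure_mono (biInter_subset_of_mem (le_refl m))).trans
    (measure_gridPassage_le hW.toIsPreBrownianReal a hc hT m)

lemma le_measure_exists_drift_gt (hW : IsBrownianReal W P) {a d c : ℝ} (ha : 0 ≤ a) (hd : 0 < d)
    (hc : 0 ≤ c) {T : ℝ≥0} (hT : 0 < T) :
    ∫⁻ ω, reflWeight c (W T ω - c * T - a - d) ∂P ≤ P {ω | ∃ t ≤ T, a < W t ω - c * t} := by
  have hW' := hW.toIsPreBrownianReal
  set U : ℕ → Set Ω := fun n => ⋃ k ∈ Finset.range n, gridPassage W c a T n (Ioc a (a + d)) k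
    with hU
  have hnull : ∀ n, NullMeasurableSet (U n) P := fun n =>
    Finset.nullMeasurableSet_biUnion _ fun k _ =>
      nullMeasurableSet_gridPassage hW' c a T n measurableSet_Ioc k
  set f : Ω → ℝ≥0∞ := fun ω => reflWeight c (W T ω - c * T - a - d) with hf
  have hfm : AEMeasurable f P := (measurable_reflWeight c).comp_aemeasurable
    ((((hW'.aemeasurable T).sub_const _).sub_const _).sub_const _)
  -- Either `X T > a + d` and all fine grids detect the passage with small overshoot, or the weight
  -- is zero. Fatou's lemma then applies.
  have hlim : ∀ᵐ ω ∂P, f ω ≤ liminf (fun n => (U n).indicator f ω) atTop := by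
    filter_upwards [hW.cont, hW'.eval_zero_ae_eq_zero] with ω hω hω0
    by_cases hX : a + d < W T ω - c * T
    · have hx : Continuous fun t : ℝ≥0 => W t ω - c * t := by fun_prop
      have hev := eventually_exists_first_gridPoint (a := a) hx hT (by simp [hω0, ha]) hd (by linarith)
      refine le_liminf_of_le (by isBoundedDefault) ?_
      filter_upwards [hev] with n hn
      obtain ⟨k, hk, h1, h2⟩ := hn
      have hmem : ω ∈ U n := mem_iUnion₂.2 ⟨k, Finset.mem_range.2 hk, h1, h2⟩
      rw [indicator_of_mem hmem]
    · have : f ω = 0 := indicator_of_notMem (by simp only [mem_Ioi]; linarith) _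
      rw [this]
      exact zero_le
  calc ∫⁻ ω, f ω ∂P ≤ ∫⁻ ω, liminf (fun n => (U n).indicator f ω) atTop ∂P :=
        lintegral_mono_ae hlim
    _ ≤ liminf (fun n => ∫⁻ ω, (U n).indicator f ω ∂P) atTop :=
        lintegral_liminf_le' fun n => hfm.indicator₀ (hnull n)
    _ ≤ _ := by
        refine liminf_le_of_frequently_le' (Frequently.of_forall fun n => ?_)
        rw [lintegral_indicator₀ (hnull n)]
        refine (le_measure_gridPassage hW' a d hc hT n).trans (measure_mono fun ω hω => ?_)
        obtain ⟨k, hk, h⟩ := mem_iUnion₂.1 hω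
        exact ⟨_, (gridPoint_lt hT (Finset.mem_range.1 hk)).le, h.1.1⟩

/-- The law of the maximum over `[0, T]` of a Brownian motion with drift `-c`. -/
theorem measure_exists_drift_gt (hW : IsBrownianReal W P) {a c : ℝ} (ha : 0 ≤ a) (hc : 0 ≤ c)
    {T : ℝ≥0} (hT : 0 < T) :
    P {ω | ∃ t ≤ T, a < W t ω - c * t} = gaussianReal (-(c * T)) T (Ioi a) +
        ENNReal.ofReal (Real.exp (-(2 * c * a))) * gaussianReal (c * T) T (Ioi a) := by
  have hW' := hW.toIsPreBrownianReal
  rw [← lintegral_reflWeight a c hT.ne', ← lintegral_reflWeight_drift hW']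
  refine le_antisymm (measure_exists_drift_gt_le hW a hc hT) ?_
  set d : ℕ → ℝ := fun n => 1 / ((n : ℝ) + 1) with hd
  have hd0 : ∀ n, 0 < d n := fun n => by simp only [hd]; positivity
  have hlim : ∀ ω, reflWeight c (W T ω - c * T - a) =
      liminf (fun n => reflWeight c (W T ω - c * T - a - d n)) atTop := fun ω =>
    (tendsto_reflWeight_sub c _ tendsto_one_div_add_atTop_nhds_zero_nat
      fun n => (hd0 n).le).liminf_eq.symm
  simp_rw [hlim]
  refine (lintegral_liminf_le' fun n => (measurable_reflWeight c).comp_aemeasurable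
    ((((hW'.aemeasurable T).sub_const _).sub_const _).sub_const _)).trans ?_
  exact liminf_le_of_frequently_le' (Frequently.of_forall fun n =>
    le_measure_exists_drift_gt hW ha (hd0 n) hc hT)

end ManySource

namespace ManySource

/-! ### Gaussian tails and Mills' ratio -/

open Set
open scoped ENNReal Topology

/-- The tail function of the standard Gaussian distribution. -/
noncomputable def gaussianTail (x : ℝ) : ℝ := (gaussianReal 0 1).real (Ioi x)

lemma gaussianReal_real_Ioi (μ a : ℝ) {v : ℝ≥0} (hv : v ≠ 0) :
    (gaussianReal μ v).real (Ioi a) = gaussianTail ((a - μ) / √(v : ℝ)) := by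
  have hv' : 0 < √(v : ℝ) := Real.sqrt_pos.2 (by positivity)
  have hmap : gaussianReal μ v = ((gaussianReal 0 1).map (√(v : ℝ) * ·)).map (· + μ) := by
    rw [gaussianReal_map_const_mul, gaussianReal_map_add_const, mul_zero, zero_add, mul_one]
    congr 1
    exact NNReal.coe_injective (Real.sq_sqrt v.coe_nonneg).symm
  rw [gaussianTail, hmap, map_measureReal_apply (by fun_prop) measurableSet_Ioi,
    map_measureReal_apply (by fun_prop) (measurableSet_Ioi.preimage (by fun_prop))]
  congr 1
  ext x
  simp only [mem_preimage, mem_Ioi]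
  rw [div_lt_iff₀ hv', mul_comm x, sub_lt_iff_lt_add]

/-- With `c = 0` the weight is `2` on the positive half-line, and its mean is `1`. -/
lemma gaussianTail_zero : gaussianTail 0 = 1 / 2 := by
  have h := lintegral_reflWeight 0 0 (one_ne_zero (α := ℝ≥0))
  have h1 := lintegral_reflWeight_zero 0 (one_ne_zero (α := ℝ≥0))
  simp only [sub_zero, mul_zero, neg_zero, Real.exp_zero, ENNReal.ofReal_one, one_mul,
    zero_mul] at h h1
  rw [h1] at h
  have h2 := congrArg ENNReal.toReal h
  rw [ENNReal.toReal_add (measure_ne_top _ _) (measure_ne_top _ _), ENNReal.toReal_one] at h2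
  simp only [gaussianTail, measureReal_def]
  linarith

lemma tendsto_gaussianTail_atBot : Tendsto gaussianTail atBot (𝓝 1) := by
  have h : ∀ x, gaussianTail x = 1 - cdf (gaussianReal 0 1) x := fun x => by
    rw [gaussianTail, cdf_eq_real, ← compl_Iic, measureReal_compl measurableSet_Iic, probReal_univ]
  simpa [funext h] using (tendsto_cdf_atBot (gaussianReal 0 1)).const_sub 1

lemma gaussianTail_eq_integral (x : ℝ) :
    gaussianTail x = ∫ y in Ioi x, gaussianPDFReal 0 1 y := by
  rw [gaussianTail, measureReal_def, gaussianReal_apply_eq_integral _ one_ne_zero,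
    ENNReal.toReal_ofReal]
  exact integral_nonneg fun y => gaussianPDFReal_nonneg _ _ _

lemma gaussianPDFReal_zero_one (x : ℝ) :
    gaussianPDFReal 0 1 x = (√(2 * Real.pi))⁻¹ * Real.exp (-x ^ 2 / 2) := by
  simp [gaussianPDFReal]

/-- As `φ' = -yφ`, this is an explicit antiderivative. On `y > x > 0` the factor `1 + 1/y²` lies
between `1` and `1 + 1/x²`, which yields both Mills bounds. -/
lemma hasDerivAt_neg_gaussianPDFReal_div {y : ℝ} (hy : y ≠ 0) :
    HasDerivAt (fun y => -(gaussianPDFReal 0 1 y / y))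
      (gaussianPDFReal 0 1 y * (1 + 1 / y ^ 2)) y := by
  have hexp : HasDerivAt (fun y : ℝ => (√(2 * Real.pi))⁻¹ * Real.exp (-y ^ 2 / 2))
      ((√(2 * Real.pi))⁻¹ * (Real.exp (-y ^ 2 / 2) * (-y))) y := by
    refine HasDerivAt.const_mul _ (HasDerivAt.exp ?_)
    have := ((hasDerivAt_pow 2 y).neg).div_const 2
    refine this.congr_deriv ?_
    norm_num
    ring
  have := (hexp.div (hasDerivAt_id y) hy).neg
  simp_rw [gaussianPDFReal_zero_one]
  refine this.congr_deriv ?_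
  simp only [id]
  field_simp
  ring

lemma tendsto_gaussianPDFReal_div :
    Tendsto (fun y => -(gaussianPDFReal 0 1 y / y)) atTop (𝓝 0) := by
  have h1 : Tendsto (fun y : ℝ => (√(2 * Real.pi))⁻¹ / y) atTop (𝓝 0) :=
    tendsto_const_nhds.div_atTop tendsto_id
  have h2 : Tendsto (fun y : ℝ => gaussianPDFReal 0 1 y / y) atTop (𝓝 0) := by
    refine squeeze_zero' ?_ ?_ h1
    · filter_upwards [eventually_gt_atTop 0] with y hy
      have := gaussianPDFReal_nonneg 0 1 y
      positivity
    · filter_upwards [eventually_gt_atTop 0] with y hy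
      rw [gaussianPDFReal_zero_one]
      gcongr
      refine mul_le_of_le_one_right (by positivity) (Real.exp_le_one_iff.2 ?_)
      nlinarith [sq_nonneg y]
  simpa using h2.neg

lemma integrableOn_gaussianPDFReal_mul {x : ℝ} (hx : 0 < x) :
    IntegrableOn (fun y => gaussianPDFReal 0 1 y * (1 + 1 / y ^ 2)) (Ioi x) :=
  integrableOn_Ioi_deriv_of_nonneg'
    (fun y hy => hasDerivAt_neg_gaussianPDFReal_div (hx.trans_le hy).ne')
    (fun y _ => mul_nonneg (gaussianPDFReal_nonneg _ _ _) (by positivity))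
    tendsto_gaussianPDFReal_div

lemma integral_gaussianPDFReal_mul {x : ℝ} (hx : 0 < x) :
    ∫ y in Ioi x, gaussianPDFReal 0 1 y * (1 + 1 / y ^ 2) = gaussianPDFReal 0 1 x / x := by
  rw [integral_Ioi_of_hasDerivAt_of_nonneg'
    (fun y hy => hasDerivAt_neg_gaussianPDFReal_div (hx.trans_le hy).ne')
    (fun y _ => mul_nonneg (gaussianPDFReal_nonneg _ _ _) (by positivity))
    tendsto_gaussianPDFReal_div]
  ring

lemma gaussianTail_le {x : ℝ} (hx : 0 < x) : gaussianTail x ≤ gaussianPDFReal 0 1 x / x := by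
  rw [gaussianTail_eq_integral, ← integral_gaussianPDFReal_mul hx]
  refine setIntegral_mono_on (integrable_gaussianPDFReal 0 1).integrableOn
    (integrableOn_gaussianPDFReal_mul hx) measurableSet_Ioi fun y _ => ?_
  refine le_mul_of_one_le_right (gaussianPDFReal_nonneg _ _ _) ?_
  have : 0 ≤ 1 / y ^ 2 := by positivity
  linarith

lemma le_gaussianTail {x : ℝ} (hx : 0 < x) :
    gaussianPDFReal 0 1 x / x ≤ gaussianTail x * (1 + 1 / x ^ 2) := by
  rw [gaussianTail_eq_integral, ← integral_gaussianPDFReal_mul hx, ← integral_mul_const]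
  refine setIntegral_mono_on (integrableOn_gaussianPDFReal_mul hx)
    ((integrable_gaussianPDFReal 0 1).integrableOn.mul_const _) measurableSet_Ioi fun y hy => ?_
  have h0 := gaussianPDFReal_nonneg 0 1 y
  have hy' : x ≤ y := hy.le
  gcongr

/-- The Mills ratio of the standard Gaussian distribution is asymptotic to `1 / x`. -/
lemma tendsto_gaussianTail_mul :
    Tendsto (fun x => gaussianTail x * (√(2 * Real.pi) * x * Real.exp (x ^ 2 / 2))) atTop
      (𝓝 1) := by
  have hlow : Tendsto (fun x : ℝ => (1 + 1 / x ^ 2)⁻¹) atTop (𝓝 1) := by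
    have h1 : Tendsto (fun x : ℝ => 1 / x ^ 2) atTop (𝓝 0) :=
      tendsto_const_nhds.div_atTop (tendsto_pow_atTop two_ne_zero)
    simpa using (h1.const_add 1).inv₀ (by norm_num)
  have hpi : √(2 * Real.pi) ≠ 0 := by positivity
  have key : ∀ x : ℝ, 0 < x →
      gaussianPDFReal 0 1 x / x * (√(2 * Real.pi) * x * Real.exp (x ^ 2 / 2)) = 1 := by
    intro x hx
    rw [gaussianPDFReal_zero_one, neg_div, Real.exp_neg]
    field_simp
  refine tendsto_of_tendsto_of_tendsto_of_le_of_le' hlow tendsto_const_nhds ?_ ?_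
  · filter_upwards [eventually_gt_atTop 0] with x hx
    rw [inv_le_iff_one_le_mul₀ (by positivity)]
    calc (1 : ℝ) = gaussianPDFReal 0 1 x / x * (√(2 * Real.pi) * x * Real.exp (x ^ 2 / 2)) :=
          (key x hx).symm
      _ ≤ gaussianTail x * (1 + 1 / x ^ 2) * (√(2 * Real.pi) * x * Real.exp (x ^ 2 / 2)) := by
          gcongr
          exact le_gaussianTail hx
      _ = _ := by ring
  · filter_upwards [eventually_gt_atTop 0] with x hx
    rw [← key x hx]
    gcongr
    exact gaussianTail_le hx

/-- The law of the maximum over `[0, T]` of a Brownian motion with drift `-c`, in terms of the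
standard Gaussian tail. -/
lemma measureReal_exists_drift_gt {Ω : Type*} [MeasurableSpace Ω] {P : Measure Ω}
    {W : ℝ≥0 → Ω → ℝ} (hW : IsBrownianReal W P) {a c : ℝ} (ha : 0 ≤ a) (hc : 0 ≤ c) {T : ℝ≥0}
    (hT : 0 < T) :
    P.real {ω | ∃ t ≤ T, a < W t ω - c * t} = gaussianTail ((a + c * T) / √(T : ℝ)) +
      Real.exp (-(2 * c * a)) * gaussianTail ((a - c * T) / √(T : ℝ)) := by
  rw [measureReal_def, measure_exists_drift_gt hW ha hc hT,
    ENNReal.toReal_add (measure_ne_top _ _) (by finiteness), ENNReal.toReal_mul,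
    ENNReal.toReal_ofReal (Real.exp_pos _).le, ← measureReal_def, ← measureReal_def,
    gaussianReal_real_Ioi _ _ hT.ne', gaussianReal_real_Ioi _ _ hT.ne', sub_neg_eq_add]

/-! ### Reduction to one Brownian motion -/

/-- The normalized sum of independent Brownian motions is a Brownian motion. -/
lemma IsIndepBrownian.isBrownianReal_sum {Ω : Type*} [MeasurableSpace Ω] {P : Measure Ω} {N : ℕ}
    {B : Fin N → ℝ≥0 → Ω → ℝ} (hB : IsIndepBrownian P B) (hN : N ≠ 0) :
    IsBrownianReal (fun t ω => (√(N : ℝ))⁻¹ * ∑ k, B k t ω) P := by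
  have hpre : ∀ k, IsPreBrownianReal (B k) P := fun k => (hB.brownian k).toIsPreBrownianReal
  have hP : IsProbabilityMeasure P := hB.indep.isProbabilityMeasure
  have hmem : ∀ k t, MemLp (B k t) 2 P := fun k t =>
    ((hpre k).hasLaw_eval t).hasGaussianLaw.memLp_two
  have hgauss : IsGaussianProcess (fun t ω => ∑ k, B k t ω) P := by
    refine ⟨fun I => ?_⟩
    have hind : iIndepFun (fun k ω => I.restrict (B k · ω)) P :=
      hB.indep.comp (fun _ x => I.restrict x) fun _ => Finset.measurable_restrict I
    have := iIndepFun.hasGaussianLaw_fun_sum (fun k => ((hpre k).hasLaw I).hasGaussianLaw) hind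
    convert! this using 2 with ω
    ext i
    simp
  have hcov : ∀ s t, s ≤ t → cov[fun ω => ∑ k, B k s ω, fun ω => ∑ k, B k t ω; P] = N * s := by
    intro s t hst
    rw [covariance_fun_sum_fun_sum (fun k => hmem k s) (fun k => hmem k t)]
    have hk : ∀ i j, cov[fun ω => B i s ω, fun ω => B j t ω; P] = if i = j then (s : ℝ) else 0 := by
      intro i j
      split_ifs with h
      · subst h
        rw [(hpre i).covariance_fun_eval, min_eq_left hst]
      · have := (hB.indep.indepFun h).comp (measurable_pi_apply s) (measurable_pi_apply t)
        exact this.covariance_eq_zero (hmem i s) (hmem j t)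
    simp [hk]
  refine ⟨IsGaussianProcess.isPreBrownianReal_of_covariance (hgauss.smul fun _ => (√(N : ℝ))⁻¹)
    (fun t => ?_) fun s t hst => ?_, ?_⟩
  · rw [integral_const_mul, integral_finsetSum _ fun k _ => (hpre k).integrable_eval t]
    simp [(hpre _).integral_eval]
  · rw [covariance_const_mul_left, covariance_const_mul_right, hcov s t hst]
    have hN' : (0 : ℝ) < N := by exact_mod_cast hN.bot_lt
    rw [← mul_assoc, ← mul_assoc, ← mul_inv, Real.mul_self_sqrt hN'.le, inv_mul_cancel₀ hN'.ne',
      one_mul]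
  · filter_upwards [ae_all_iff.2 fun k => (hB.brownian k).cont] with ω hω
    exact continuous_const.mul (continuous_finsetSum _ fun k _ => hω k)

lemma lt_supremum_iff {Ω : Type*} {N : ℕ} (B : Fin N → ℝ≥0 → Ω → ℝ) (c r : ℝ) (T : ℝ≥0) (ω : Ω) :
    supremum B c T ω > (r : EReal) ↔ ∃ t ≤ T, r < (∑ k, B k t ω) - c * N * t := by
  rw [supremum, gt_iff_lt, lt_iSup_iff]
  simp [EReal.coe_lt_coe_iff, -EReal.coe_sub, -EReal.coe_mul]

/-- When the lines meet after time `T`, the joint exceedance probability is the probability of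
exceeding the higher line, which is explicit. -/
lemma psi_eq {Ω : Type*} [MeasurableSpace Ω] {P : Measure Ω} {N : ℕ} {B : Fin N → ℝ≥0 → Ω → ℝ}
    (hB : IsIndepBrownian P B) (hN : N ≠ 0) {a₁ a₂ c₁ c₂ : ℝ} {T : ℝ≥0} (ha₂ : 0 ≤ a₂)
    (hc₂ : 0 ≤ c₂) (hc : c₂ < c₁) (hT : 0 < T) (htT : (T : ℝ) ≤ tStar a₁ a₂ c₁ c₂) :
    psi P B a₁ a₂ c₁ c₂ T = gaussianTail (√(N : ℝ) * ((a₂ + c₂ * T) / √(T : ℝ))) +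
      Real.exp (-2 * a₂ * c₂ * N) * gaussianTail (√(N : ℝ) * ((a₂ - c₂ * T) / √(T : ℝ))) := by
  have hN' : (0 : ℝ) < N := by exact_mod_cast hN.bot_lt
  have hs : 0 < √(N : ℝ) := Real.sqrt_pos.2 hN'
  have hss : √(N : ℝ) * √(N : ℝ) = N := Real.mul_self_sqrt hN'.le
  have hset : {ω | supremum B c₁ T ω > ((a₁ * N : ℝ) : EReal) ∧
      supremum B c₂ T ω > ((a₂ * N : ℝ) : EReal)} =
      {ω | ∃ t ≤ T, √(N : ℝ) * a₂ < (√(N : ℝ))⁻¹ * ∑ k, B k t ω - √(N : ℝ) * c₂ * t} := by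
    ext ω
    have hiff : ∀ t : ℝ≥0, a₂ * N < (∑ k, B k t ω) - c₂ * N * t ↔
        √(N : ℝ) * a₂ < (√(N : ℝ))⁻¹ * ∑ k, B k t ω - √(N : ℝ) * c₂ * t := by
      intro t
      rw [← mul_lt_mul_iff_right₀ hs (b := √(N : ℝ) * a₂), mul_sub, mul_inv_cancel_left₀ hs.ne',
        ← mul_assoc, ← mul_assoc, ← mul_assoc, hss, mul_comm a₂, mul_comm c₂]
    simp only [mem_ofPred_eq, lt_supremum_iff, ← hiff]
    refine ⟨fun h => h.2, fun h => ⟨?_, h⟩⟩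
    obtain ⟨t, ht, h⟩ := h
    refine ⟨t, ht, ?_⟩
    -- As `t ≤ T ≤ t*`, the first line is below the second at `t`, so the same time witnesses both
    -- exceedances.
    have htT' : (t : ℝ) * (c₁ - c₂) ≤ a₂ - a₁ := by
      rw [tStar, le_div_iff₀ (by linarith)] at htT
      have : (t : ℝ) ≤ T := ht
      nlinarith
    nlinarith
  rw [psi, hset, measureReal_exists_drift_gt (hB.isBrownianReal_sum hN) (by positivity)
    (by positivity) hT]
  congr 2
  · ring_nf
  · congr 1
    linear_combination (-2 * a₂ * c₂) * hss
  · ring_nf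

end ManySource

/-! ### Asymptotics in the three regimes -/

open scoped Topology

theorem theorem2p4 {Ω : ℕ → Type*} [∀ N, MeasurableSpace (Ω N)]
    (P : ∀ N, Measure (Ω N)) [∀ N, IsProbabilityMeasure (P N)]
    (B : ∀ N, Fin N → ℝ≥0 → Ω N → ℝ) (hB : ∀ N, ManySource.IsIndepBrownian (P N) (B N))
    (a₁ a₂ c₁ c₂ : ℝ) (T : ℝ≥0)
    (ha₁ : 0 < a₁) (ha : a₁ < a₂) (hc₂ : 0 < c₂) (hc : c₂ < c₁) (hT : 0 < T)
    (htT : (T : ℝ) ≤ ManySource.tStar a₁ a₂ c₁ c₂) :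
    ((T : ℝ) < ManySource.critTime a₂ c₂ →
      (fun N : ℕ => ManySource.psi (P N) (B N) a₁ a₂ c₁ c₂ T) ~[atTop]
        (fun N : ℕ => 1 / √(2 * Real.pi) *
          (√(T : ℝ) / (a₂ + c₂ * T) + √(T : ℝ) / (a₂ - c₂ * T)) *
          (1 / √(N : ℝ)) * Real.exp (-((a₂ + c₂ * T) ^ 2 / (2 * T)) * N))) ∧
    (ManySource.critTime a₂ c₂ = (T : ℝ) →
      (fun N : ℕ => ManySource.psi (P N) (B N) a₁ a₂ c₁ c₂ T) ~[atTop]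
        (fun N : ℕ => 1 / 2 * Real.exp (-2 * a₂ * c₂ * N))) ∧
    (ManySource.critTime a₂ c₂ < (T : ℝ) →
      (fun N : ℕ => ManySource.psi (P N) (B N) a₁ a₂ c₁ c₂ T) ~[atTop]
        (fun N : ℕ => Real.exp (-2 * a₂ * c₂ * N))) := by
  open ManySource in
  have hT' : (0 : ℝ) < T := hT
  have ha₂ : 0 < a₂ := ha₁.trans ha
  have hsT : 0 < √(T : ℝ) := Real.sqrt_pos.2 hT'
  have hsT2 : √(T : ℝ) ^ 2 = T := Real.sq_sqrt hT'.le
  set u : ℝ := (a₂ + c₂ * T) / √(T : ℝ) with hu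
  set v : ℝ := (a₂ - c₂ * T) / √(T : ℝ) with hv
  have hu0 : 0 < u := by positivity
  have hu2 : u ^ 2 / 2 = (a₂ + c₂ * T) ^ 2 / (2 * T) := by
    rw [hu, div_pow, hsT2, div_div, mul_comm (T : ℝ) 2]
  have huv : u ^ 2 / 2 = 2 * a₂ * c₂ + v ^ 2 / 2 := by
    rw [hu, hv, div_pow, div_pow, hsT2]
    field_simp
    ring
  have hsN : Tendsto (fun N : ℕ => √(N : ℝ)) atTop atTop :=
    Real.tendsto_sqrt_atTop.comp tendsto_natCast_atTop_atTop
  set M : ℝ → ℝ := fun x => gaussianTail x * (√(2 * Real.pi) * x * Real.exp (x ^ 2 / 2)) with hM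
  have hMlim : ∀ {w : ℝ}, 0 < w → Tendsto (fun N : ℕ => M (√(N : ℝ) * w)) atTop (𝓝 1) :=
    fun hw => tendsto_gaussianTail_mul.comp (hsN.atTop_mul_const hw)
  have hpi : √(2 * Real.pi) ≠ 0 := by positivity
  have htail : ∀ {w : ℝ}, 0 < w → ∀ {N : ℕ}, N ≠ 0 → gaussianTail (√(N : ℝ) * w) =
      1 / √(2 * Real.pi) * (1 / √(N : ℝ)) * Real.exp (-(w ^ 2 / 2) * N) *
        (M (√(N : ℝ) * w) / w) := by
    intro w hw N hN
    have hN' : (0 : ℝ) < N := by exact_mod_cast hN.bot_lt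
    have hs : 0 < √(N : ℝ) := Real.sqrt_pos.2 hN'
    have he : Real.exp ((√(N : ℝ) * w) ^ 2 / 2) = (Real.exp (-(w ^ 2 / 2) * N))⁻¹ := by
      rw [← Real.exp_neg, mul_pow, Real.sq_sqrt hN'.le]
      ring_nf
    have := (Real.exp_pos (-(w ^ 2 / 2) * N)).ne'
    simp only [hM, he]
    field_simp
  have hpsi : ∀ᶠ N : ℕ in atTop, psi (P N) (B N) a₁ a₂ c₁ c₂ T =
      gaussianTail (√(N : ℝ) * u) + Real.exp (-2 * a₂ * c₂ * N) * gaussianTail (√(N : ℝ) * v) := by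
    filter_upwards [eventually_ne_atTop 0] with N hN
    exact psi_eq (hB N) hN ha₂.le hc₂.le hc hT htT
  -- Cases (ii) and (iii): after division by `exp (-2a₂c₂N)` the `u`-tail is of order at most
  -- `1/√N`, so the limit of the `v`-tail alone gives the constant.
  have hasymp : ∀ {l : ℝ}, l ≠ 0 → Tendsto (fun N : ℕ => gaussianTail (√(N : ℝ) * v)) atTop (𝓝 l) →
      (fun N : ℕ => psi (P N) (B N) a₁ a₂ c₁ c₂ T) ~[atTop]
        (fun N : ℕ => l * Real.exp (-2 * a₂ * c₂ * N)) := by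
    intro l hl hlim
    have hrest : Tendsto (fun N : ℕ => 1 / √(2 * Real.pi) * (1 / √(N : ℝ)) *
        Real.exp (-(v ^ 2 / 2) * N) * (M (√(N : ℝ) * u) / u)) atTop (𝓝 0) := by
      have h1 : Tendsto (fun N : ℕ => 1 / √(2 * Real.pi) * (1 / √(N : ℝ))) atTop (𝓝 0) := by
        simpa using (tendsto_const_nhds.div_atTop hsN : Tendsto (fun N : ℕ => 1 / √(N : ℝ)) atTop
          (𝓝 0)).const_mul (1 / √(2 * Real.pi))
      have h2 : Tendsto (fun N : ℕ => 1 / √(2 * Real.pi) * (1 / √(N : ℝ)) *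
          Real.exp (-(v ^ 2 / 2) * N)) atTop (𝓝 0) := by
        refine squeeze_zero (fun N => by positivity) (fun N => ?_) h1
        refine mul_le_of_le_one_right (by positivity) (Real.exp_le_one_iff.2 ?_)
        rw [neg_mul]
        exact neg_nonpos.2 (by positivity)
      simpa using h2.mul ((hMlim hu0).div_const u)
    have hsum := (isEquivalent_const_iff_tendsto hl).2 ((add_zero l ▸ hlim.add hrest :))
    refine (hsum.mul (IsEquivalent.refl (u := fun N : ℕ => Real.exp (-2 * a₂ * c₂ * N)))).congr_left
      ?_
    filter_upwards [hpsi, eventually_ne_atTop 0] with N hN hN0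
    have he : Real.exp (-(u ^ 2 / 2) * N) =
        Real.exp (-(v ^ 2 / 2) * N) * Real.exp (-2 * a₂ * c₂ * N) := by
      rw [huv, ← Real.exp_add]
      ring_nf
    rw [hN, htail hu0 hN0, he]
    simp only [Pi.mul_apply]
    ring
  refine ⟨fun h => ?_, fun h => ?_, fun h => ?_⟩
  · rw [critTime, lt_div_iff₀ hc₂] at h
    have hv0 : 0 < v := div_pos (by linarith) hsT
    -- Both tails share the factor `exp (-u²N/2)/√(2πN)`; what remains tends to `1/u + 1/v`.
    have hsum : Tendsto (fun N : ℕ => M (√(N : ℝ) * u) / u + M (√(N : ℝ) * v) / v) atTop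
        (𝓝 (1 / u + 1 / v)) := ((hMlim hu0).div_const u).add ((hMlim hv0).div_const v)
    have hequiv := ((isEquivalent_const_iff_tendsto (by positivity)).2 hsum).mul
      (IsEquivalent.refl (u := fun N : ℕ => 1 / √(2 * Real.pi) * (1 / √(N : ℝ)) *
        Real.exp (-(u ^ 2 / 2) * N)))
    refine (hequiv.congr_left ?_).congr_right (Eventually.of_forall fun N => ?_)
    · filter_upwards [hpsi, eventually_ne_atTop 0] with N hN hN0
      have he : Real.exp (-(u ^ 2 / 2) * N) =
          Real.exp (-2 * a₂ * c₂ * N) * Real.exp (-(v ^ 2 / 2) * N) := by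
        rw [huv, ← Real.exp_add]
        ring_nf
      rw [hN, htail hu0 hN0, htail hv0 hN0]
      simp only [Pi.mul_apply, he]
      ring
    · simp only [Pi.mul_apply, Function.const_apply, hu2]
      rw [hu, hv, one_div_div, one_div_div]
      ring
  · have hv0 : v = 0 := by
      rw [critTime, div_eq_iff hc₂.ne'] at h
      rw [hv, h, mul_comm, sub_self, zero_div]
    refine hasymp (by norm_num) ?_
    simp only [hv0, mul_zero, gaussianTail_zero]
    exact tendsto_const_nhds
  · rw [critTime, div_lt_iff₀ hc₂] at h
    have hv0 : v < 0 := div_neg_of_neg_of_pos (by linarith) hsT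
    simpa using hasymp one_ne_zero
      (tendsto_gaussianTail_atBot.comp (hsN.atTop_mul_const_of_neg hv0))
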